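/- Conventions. A hypergraph is $r$-uniform if each of its edges has exactly $r$ vertices, and $r$-partite if its vertex set can be partitioned into $r$ parts such that each edge contains exactly one vertex of each part. A matching of size $t$ is a set of $t$ pairwise disjoint edges; it is perfect if it covers all vertices. Given a family of matchings $M_1,\dots,M_N$ (repetitions allowed), a rainbow matching of size $t$ consists of pairwise disjoint edges $e_1\in M_{i_1},\dots,e_t\in M_{i_t}$ with distinct indices $i_1,\dots,i_t\in\{1,\dots,N\}$. Let $f(r,t)$ be the maximum $N$ for which there exist matchings $M_1,\dots,M_N$ of size $t$ in some $r$-partite $r$-uniform hypergraph without a rainbow matching of size $t$. Theorem. For every $t\ge 2$ there is a constant $D_t\ge 0$, depending only on $t$, such that for every $r\ge 2$ the maximum $f(r,t)$ exists and $$t^{\,r-D_t\sqrt r}\;\le\; f(r,t)\;\le\;(t-1)\cdot t^r .$$ Moreover, for every $r\ge 2$ there exist $N\ge t^{\,r-D_t\sqrt r}$ and perfect matchings $M_1,\dots,M_N$ of size $t$ in some $r$-partite $r$-uniform hypergraph with $tr$ vertices such that for any pairwise disjoint edges $e_1\in M_{j_1},\dots,e_t\in M_{j_t}$ (with indices $j_1,\dots,j_t\in\{1,\dots,N\}$)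 we have $j_1=\dots=j_t$. -/

import Mathlib

namespace RainbowMatching

/-- Every edge has exactly `r` vertices. -/
def IsUniform {α : Type} (H : Hypergraph α) (r : ℕ) : Prop :=
  ∀ e ∈ H.edgeSet, e.encard = r

/-- The vertex set is partitioned into `r` parts (some of which may be empty) such that every
edge has exactly one vertex in each part. -/
def IsPartite {α : Type} (H : Hypergraph α) (r : ℕ) : Prop :=
  ∃ P : Fin r → Set α, (⋃ i, P i) = H.vertexSet ∧ Pairwise (fun i k => Disjoint (P i) (P k)) ∧
    ∀ e ∈ H.edgeSet, ∀ i, ∃! v, v ∈ e ∧ v ∈ P i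

/-- `M` is a matching of size `t` in `H`: a set of `t` pairwise disjoint edges of `H`. -/
def IsMatchingOfSize {α : Type} (H : Hypergraph α) (t : ℕ) (M : Finset (Set α)) : Prop :=
  (∀ e ∈ M, e ∈ H.edgeSet) ∧ (M : Set (Set α)).PairwiseDisjoint id ∧ M.card = t

/-- The family `M` of matchings (one for each colour in `Fin N`) has a rainbow matching of
size `t`: pairwise disjoint edges `e 1, …, e t` taken from matchings with distinct indices. -/
def HasRainbowMatching {α : Type} {N : ℕ} (M : Fin N → Finset (Set α)) (t : ℕ) : Prop :=
  ∃ (j : Fin t → Fin N) (e : Fin t → Set α), Function.Injective j ∧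
    (∀ k, e k ∈ M (j k)) ∧ Pairwise (fun k l => Disjoint (e k) (e l))

/-- The set of all `N` for which there is a family of `N` matchings of size `t` (repetitions
allowed) in some `r`-partite `r`-uniform hypergraph that has no rainbow matching of size `t`. -/
def rainbowFreeSizes (r t : ℕ) : Set ℕ :=
  {N | ∃ (α : Type) (H : Hypergraph α) (M : Fin N → Finset (Set α)),
    IsUniform H r ∧ IsPartite H r ∧ (∀ j, IsMatchingOfSize H t (M j)) ∧
    ¬ HasRainbowMatching M t}

/-- The maximum possible number of matchings of size `t` in some `r`-partite `r`-uniform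
hypergraph without a rainbow matching of size `t`. -/
noncomputable def f (r t : ℕ) : ℕ := sSup (rainbowFreeSizes r t)

end RainbowMatching

/-!
**Upper bound.** Give the vertices distinct labels `a v` in a large field `K`, and send an
edge with vertices `v_p` (one in each part `p`) to the tensor `⊗_p (1, a v_p, …, a v_p ^ (t - 1))`
in `(K^t)^{⊗ r}`, a space of dimension `t ^ r`. The tensor product of `r` determinants is a
`t`-linear form which, by Vandermonde, is nonzero on `t` edges exactly if they are pairwise disjoint
(`tensorDet`). If there are more than `(t - 1) * t ^ r` matchings, then one can choose disjoint index
sets for `t - 1` of the slots that span everything that is not chosen, and some index `i₀` is left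
over. Expanding the nonzero value at the matching `i₀` in these spanning sets yields a nonzero value
at edges with pairwise distinct indices, that is, a rainbow matching
(`exists_injective_ne_zero`).

**Lower bound.** Let `r = n + 1`. The first vertex of an edge records its slot `k`, and a perfect
matching is then a tuple `x` of `n` permutations of the `t` slots. The edges are hashed into the group
`G = (ℤ/q)^m` with `m ≈ √r`, by a random function that is additive over the coordinates, and only
those matchings are kept whose edges all have the same hash `b`, where `b` lies in a Behrend-type set
`B ⊆ G`. The hashes of the `t` edges of any perfect matching satisfy a fixed linear relation, so
every perfect matching made of kept edges has a constant hash, because `B` admits only trivial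
solutions (`exists_large_sphere`). Finally, a matching is discarded if it shares an edge with
another matching of the same hash; what is left has the required property
(`eq_of_mem_isolatedTuples`).

It remains to see that at most half of the matchings are discarded on average. For matchings `x` and
`y` put `τ p = (x p)⁻¹ * y p`. The probability that `y` has the same hash as `x`, given that `x` is
kept, is governed by the orbits of the group generated by the `τ p`: it is at most `|G| ^ (d - t)`
if there are `d` orbits (`exists_orbit_representative`). The number of tuples `τ` that preserve a
given partition with classes of sizes `s i` is `∏ i, (s i)! ^ n`. A shared edge forces an orbit of
size one, so all `s i ≤ t - 1`, and the expected number of such `y` is small as soon as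
`|G| ^ (t - 2)` exceeds `(t - 1)! ^ n` by a constant factor (`sum_card_solutions_le`). With `q`
minimal for this (`exists_modulus`), `t ^ r` times a factor `exp (-O(√r))` of the matchings survive
(`exists_many_tuples`); both the density of `B` and the rounding of `q` cost only such a factor.
-/

/-! ### The upper bound: multilinear forms and Vandermonde determinants -/

/-- Greedy choice: for every slot `k ∈ s` a set `I k` of at most `dim V` indices, disjoint for
different slots, such that the vectors of slot `k` with an unused index lie in the span of those
with index in `I k`. -/
lemma exists_disjoint_spanning_indices {K V κ ι : Type*} [Field K] [AddCommGroup V] [Module K V]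
    [FiniteDimensional K V] [DecidableEq κ] [DecidableEq ι] [Fintype ι] (v : κ → ι → V)
    (s : Finset κ) :
    ∃ I : κ → Finset ι, (∀ k ∈ s, (I k).card ≤ Module.finrank K V) ∧
      (∀ k ∈ s, ∀ l ∈ s, k ≠ l → Disjoint (I k) (I l)) ∧
      ∀ k ∈ s, ∀ i ∉ s.biUnion I, v k i ∈ Submodule.span K (v k '' (I k : Set ι)) := by
  induction s using Finset.induction_on with
  | empty => exact ⟨fun _ => ∅, by simp⟩
  | insert a s ha ih =>
    obtain ⟨I, h1, h2, h3⟩ := ih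
    obtain ⟨b, hb, -, hspan, hli⟩ := exists_linearIndepOn_extension (K := K) (v := v a)
      (linearIndepOn_empty K (v a)) (Set.empty_subset ((s.biUnion I : Finset ι) : Set ι)ᶜ)
    have hne : ∀ k ∈ s, k ≠ a := fun k hk h => ha (h ▸ hk)
    have hbt : ((b.toFinite.toFinset : Finset ι) : Set ι) = b := Set.Finite.coe_toFinset _
    have hdisj : ∀ k ∈ s, Disjoint (I k) b.toFinite.toFinset := by
      intro k hk
      rw [Finset.disjoint_left]
      intro i hi hib
      refine hb ((Set.Finite.mem_toFinset _).1 hib) ?_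
      exact Finset.mem_coe.2 (Finset.mem_biUnion.2 ⟨k, hk, hi⟩)
    have hunion : (insert a s).biUnion (Function.update I a b.toFinite.toFinset)
        = b.toFinite.toFinset ∪ s.biUnion I := by
      rw [Finset.biUnion_insert, Function.update_self]
      congr 1
      exact Finset.biUnion_congr rfl fun k hk => by rw [Function.update_of_ne (hne k hk)]
    refine ⟨Function.update I a b.toFinite.toFinset, ?_, ?_, ?_⟩
    · intro k hk
      rcases Finset.mem_insert.1 hk with rfl | hk
      · rw [Function.update_self]
        have : Fintype b := Fintype.ofFinite _
        have h := LinearIndependent.fintype_card_le_finrank hli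
        rwa [← Set.toFinset_card, ← Set.Finite.toFinset_eq_toFinset b.toFinite] at h
      · rw [Function.update_of_ne (hne k hk)]; exact h1 k hk
    · intro k hk l hl hkl
      rcases Finset.mem_insert.1 hk with hka | hks <;>
        rcases Finset.mem_insert.1 hl with hla | hls
      · exact absurd (hka.trans hla.symm) hkl
      · subst hka
        rw [Function.update_self, Function.update_of_ne hkl.symm]; exact (hdisj l hls).symm
      · subst hla
        rw [Function.update_self, Function.update_of_ne hkl]; exact hdisj k hks
      · rw [Function.update_of_ne (hne k hks), Function.update_of_ne (hne l hls)]
        exact h2 k hks l hls hkl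
    · intro k hk i hi
      rw [hunion, Finset.mem_union, not_or] at hi
      rcases Finset.mem_insert.1 hk with rfl | hk
      · rw [Function.update_self, hbt]
        exact hspan ⟨i, by simpa using hi.2, rfl⟩
      · rw [Function.update_of_ne (hne k hk)]; exact h3 k hk i hi.2

/-- If a multilinear form does not vanish on any of the tuples `(v k i)_k` of a large family, then
it does not vanish on some tuple that mixes the family with pairwise distinct indices: expand all
but one slot of an unused index `i₀` in the spanning sets chosen greedily. -/
lemma exists_injective_ne_zero {K V κ ι : Type*} [Field K] [AddCommGroup V] [Module K V]
    [FiniteDimensional K V] [Fintype κ] [DecidableEq κ] [DecidableEq ι] [Fintype ι] (v : κ → ι → V)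
    (F : MultilinearMap K (fun _ : κ => V) K) (k₀ : κ)
    (hF : ∀ i, F (fun k => v k i) ≠ 0)
    (hcard : (Fintype.card κ - 1) * Module.finrank K V < Fintype.card ι) :
    ∃ j : κ → ι, Function.Injective j ∧ F (fun k => v k (j k)) ≠ 0 := by
  obtain ⟨I, h1, h2, h3⟩ := exists_disjoint_spanning_indices (K := K) v (Finset.univ.erase k₀)
  obtain ⟨i₀, hi₀⟩ : ∃ i₀, i₀ ∉ (Finset.univ.erase k₀).biUnion I := by
    by_contra! h
    have h4 := Finset.card_biUnion_le_card_mul _ _ _ h1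
    rw [Finset.eq_univ_iff_forall.2 h, Finset.card_erase_of_mem (Finset.mem_univ _),
      Finset.card_univ, Finset.card_univ] at h4
    omega
  have key : ∀ s : Finset κ, s ⊆ Finset.univ.erase k₀ → ∃ j : κ → ι, (∀ k ∈ s, j k ∈ I k) ∧
      (∀ k ∉ s, j k = i₀) ∧ F (fun k => v k (j k)) ≠ 0 := by
    intro s
    induction s using Finset.induction_on with
    | empty => exact fun _ => ⟨fun _ => i₀, by simp, by simp, hF i₀⟩
    | insert a s ha ih =>
      intro hs
      obtain ⟨j, hj1, hj2, hj3⟩ := ih ((Finset.subset_insert _ _).trans hs)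
      by_contra! hcon
      have hz : ∀ x ∈ Submodule.span K (v a '' (I a : Set ι)),
          F (Function.update (fun k => v k (j k)) a x) = 0 := by
        intro x hx
        have hle : Submodule.span K (v a '' (I a : Set ι)) ≤
            LinearMap.ker (F.toLinearMap (fun k => v k (j k)) a) := by
          rw [Submodule.span_le]
          rintro _ ⟨i, hi, rfl⟩
          rw [SetLike.mem_coe, LinearMap.mem_ker, MultilinearMap.toLinearMap_apply]
          have := hcon (Function.update j a i) ?_ ?_
          · convert this using 2
            ext k
            by_cases hk : k = a
            · subst hk; simp
            · simp [hk]
          · intro k hk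
            by_cases hka : k = a
            · subst hka; simpa using hi
            · rw [Function.update_of_ne hka]
              exact hj1 k ((Finset.mem_insert.1 hk).resolve_left hka)
          · intro k hk
            rw [Finset.mem_insert, not_or] at hk
            rw [Function.update_of_ne hk.1]
            exact hj2 k hk.2
        exact hle hx
      refine hj3 ?_
      have h := hz (v a i₀) (h3 a (hs (Finset.mem_insert_self _ _)) i₀ hi₀)
      rwa [← hj2 a ha, Function.update_eq_self a (fun k => v k (j k))] at h
  obtain ⟨j, hj1, hj2, hj3⟩ := key _ subset_rfl
  refine ⟨j, ?_, hj3⟩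
  have hmem : ∀ k, k ≠ k₀ → k ∈ Finset.univ.erase k₀ := by simp
  have hnot : ∀ k ≠ k₀, j k ≠ i₀ := fun k hk h =>
    hi₀ (h ▸ Finset.mem_biUnion.2 ⟨k, hmem k hk, hj1 k (hmem k hk)⟩)
  have h0 : j k₀ = i₀ := hj2 k₀ (by simp)
  intro k l hkl
  by_contra hne
  by_cases hk : k = k₀
  · exact hnot l (fun h => hne (hk.trans h.symm)) (by rw [← hkl, hk, h0])
  by_cases hl : l = k₀
  · exact hnot k hk (by rw [hkl, hl, h0])
  exact Finset.disjoint_left.1 (h2 k (hmem k hk) l (hmem l hl) hne) (hj1 k (hmem k hk))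
    (hkl ▸ hj1 l (hmem l hl))

/-- The multilinear form on `(K^t)^{⊗ r}`, written as functions on `Fin r → Fin t`, that is the
tensor product of `r` copies of the determinant of `t` vectors in `K^t`. -/
noncomputable def tensorDet (K : Type*) [Field K] (r t : ℕ) :
    MultilinearMap K (fun _ : Fin t => (Fin r → Fin t) → K) K :=
  ∑ σ : Fin r → Equiv.Perm (Fin t), (∏ p, ((Equiv.Perm.sign (σ p) : ℤ) : K)) •
    (MultilinearMap.mkPiAlgebra K (Fin t) K).compLinearMap
      (fun k => LinearMap.proj (fun p => σ p k))

lemma tensorDet_vandermonde {K : Type*} [Field K] {r t : ℕ} (a : Fin t → Fin r → K) :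
    tensorDet K r t (fun k φ => ∏ p, a k p ^ (φ p : ℕ)) =
      ∏ p, (Matrix.vandermonde fun k => a k p).det := by
  have h : ∀ p, (Matrix.vandermonde fun k => a k p).det =
      ∑ σ : Equiv.Perm (Fin t), ((Equiv.Perm.sign σ : ℤ) : K) * ∏ k, a k p ^ (σ k : ℕ) := by
    intro p
    rw [← Matrix.det_transpose, Matrix.det_apply']
    rfl
  simp_rw [h]
  rw [Finset.prod_univ_sum]
  simp only [tensorDet, Fintype.piFinset_univ, sum_apply, smul_apply,
    MultilinearMap.compLinearMap_apply, MultilinearMap.mkPiAlgebra_apply, LinearMap.proj_apply,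
    smul_eq_mul, Finset.prod_mul_distrib]
  refine Finset.sum_congr rfl fun σ _ => ?_
  rw [Finset.prod_comm]

namespace RainbowMatching

lemma le_of_mem_rainbowFreeSizes {r t N : ℕ} (ht : 2 ≤ t)
    (hN : N ∈ rainbowFreeSizes r t) : N ≤ (t - 1) * t ^ r := by
  obtain ⟨α, H, M, -, ⟨P, hPV, hPd, hP⟩, hM, hR⟩ := hN
  by_contra! hlt
  refine hR ?_
  let K := FractionRing (MvPolynomial α ℚ)
  let a : α → K := fun v => algebraMap (MvPolynomial α ℚ) K (MvPolynomial.X v)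
  have ha : Function.Injective a :=
    (IsFractionRing.injective (MvPolynomial α ℚ) K).comp (MvPolynomial.X_injective)
  have henum : ∀ j, ∃ e : Fin t → Set α, Function.Injective e ∧ ∀ k, e k ∈ M j := by
    intro j
    refine ⟨fun k => (((M j).equivFinOfCardEq (hM j).2.2).symm k : Set α), ?_, fun k => ?_⟩
    · exact Subtype.val_injective.comp (Equiv.injective _)
    · exact Subtype.prop _
  choose e he heM using henum
  have heH : ∀ j k, e j k ∈ H.edgeSet := fun j k => (hM j).1 _ (heM j k)
  have hvert : ∀ j k p, ∃ v, v ∈ e j k ∧ v ∈ P p := fun j k p => (hP _ (heH j k) p).exists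
  choose x hxe hxP using hvert
  have hdet : ∀ j : Fin t → Fin N,
      tensorDet K r t (fun k φ => ∏ p, a (x (j k) k p) ^ (φ p : ℕ)) ≠ 0 ↔
        ∀ p, Function.Injective fun k => x (j k) k p := by
    intro j
    rw [tensorDet_vandermonde (fun k p => a (x (j k) k p)), Finset.prod_ne_zero_iff]
    simp only [Finset.mem_univ, true_imp_iff, Matrix.det_vandermonde_ne_zero_iff]
    exact forall_congr' fun p => ⟨fun h => h.of_comp (f := a), fun h => ha.comp h⟩
  obtain ⟨j, hj, hne⟩ := exists_injective_ne_zero (K := K)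
    (fun (k : Fin t) (i : Fin N) (φ : Fin r → Fin t) => ∏ p, a (x i k p) ^ (φ p : ℕ))
    (tensorDet K r t) ⟨0, by omega⟩ (fun i => (hdet fun _ => i).2 fun p k l hkl => by
      by_contra hne
      exact Set.disjoint_left.1 ((hM i).2.1 (heM i k) (heM i l) ((he i).ne hne))
        (hxe i k p) (by simp only at hkl; rw [hkl]; exact hxe i l p)) (by simpa using hlt)
  rw [hdet] at hne
  refine ⟨j, fun k => e (j k) k, hj, fun k => heM _ _, fun k l hkl => ?_⟩
  refine Set.disjoint_left.2 fun v hvk hvl => ?_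
  have hv : v ∈ ⋃ p, P p := hPV ▸ H.subset_vertexSet_of_mem_edgeSet' (heH _ _) hvk
  obtain ⟨p, hp⟩ := Set.mem_iUnion.1 hv
  refine hkl (hne p ?_)
  exact ((hP _ (heH (j k) k) p).unique ⟨hxe _ _ _, hxP _ _ _⟩ ⟨hvk, hp⟩).trans
    ((hP _ (heH (j l) l) p).unique ⟨hxe _ _ _, hxP _ _ _⟩ ⟨hvl, hp⟩).symm

lemma isGreatest_f {r t : ℕ} (ht : 2 ≤ t) : IsGreatest (rainbowFreeSizes r t) (f r t) := by
  have hbdd : BddAbove (rainbowFreeSizes r t) :=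
    ⟨(t - 1) * t ^ r, fun N hN => le_of_mem_rainbowFreeSizes ht hN⟩
  refine ⟨Nat.sSup_mem ⟨0, ?_⟩ hbdd, fun N hN => le_csSup hbdd hN⟩
  refine ⟨PEmpty, ⟨∅, ∅, by simp⟩, Fin.elim0, by simp [IsUniform], ⟨fun _ => ∅, by simp, ?_, ?_⟩,
    fun j => j.elim0, ?_⟩
  · intro i k _; simp
  · simp
  · rintro ⟨j, -⟩
    exact (j ⟨0, by omega⟩).elim0

end RainbowMatching

/-! ### Linear systems attached to tuples of permutations -/

open Finset in
/-- For an idempotent `f`, the fibres of `f` exceed singletons by the non-fixed points. -/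
lemma sum_card_fiber_sub_one {κ : Type*} [Fintype κ] [DecidableEq κ] {f : κ → κ}
    (hf : ∀ k, f (f k) = f k) :
    ∑ i, (#{k | f k = i} - 1) = #{k | f k ≠ k} := by
  rw [card_eq_sum_card_fiberwise (f := f) (t := univ) (fun _ _ => by simp)]
  refine sum_congr rfl fun i _ => ?_
  have h : ({k ∈ ({k | f k ≠ k} : Finset κ) | f k = i} : Finset κ) =
      ({k | f k = i} : Finset κ).erase i := by
    ext k
    simp only [mem_filter, mem_univ, true_and, mem_erase]
    constructor
    · rintro ⟨h1, rfl⟩; exact ⟨fun h => h1 h.symm, rfl⟩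
    · rintro ⟨h1, rfl⟩; exact ⟨fun h => h1 h.symm, rfl⟩
  rw [h, card_erase_eq_ite]
  split_ifs with hi
  · rfl
  · have : ({k | f k = i} : Finset κ) = ∅ := by
      refine filter_eq_empty_iff.2 fun k _ hk => hi ?_
      simp [← hk, hf]
    simp [this]

open Finset in
/-- The number of solutions `w` of the homogeneous system `∑ p, w p k = ∑ p, w p (τ p k)` over a
finite abelian group is governed by the orbits of the group generated by the permutations `τ p`;
here `f` sends each point to a representative of its orbit. The range of the associated
homomorphism contains every function whose sum over each orbit is zero. -/
lemma exists_orbit_representative {G ι κ : Type*} [AddCommGroup G] [Fintype G] [DecidableEq G]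
    [Fintype ι] [DecidableEq ι] [Fintype κ] [DecidableEq κ] (τ : ι → Equiv.Perm κ) :
    ∃ f : κ → κ, (∀ p k, f (τ p k) = f k) ∧
      (∀ k₀, (∀ p, τ p k₀ = k₀) → ∀ k, f k = f k₀ → k = k₀) ∧
      #{w : ι → κ → G | ∀ k, ∑ p, w p k = ∑ p, w p (τ p k)} *
        Fintype.card G ^ (∑ i, (#{k | f k = i} - 1)) ≤
          Fintype.card G ^ (Fintype.card ι * Fintype.card κ) := by
  let S : Setoid κ := Relation.EqvGen.setoid fun k l => ∃ p, τ p k = l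
  let f : κ → κ := fun k => (Quotient.mk S k).out
  have hfS : ∀ k, S (f k) k := fun k => Quotient.mk_out (s := S) k
  have hff : ∀ k, f (f k) = f k := fun k => by
    have : Quotient.mk S (f k) = Quotient.mk S k := Quotient.sound (hfS k)
    simp only [f] at this ⊢
    rw [this]
  have hS : ∀ k l, f k = f l → S k l := fun k l h =>
    S.trans (S.symm (hfS k)) (h ▸ hfS l)
  refine ⟨f, fun p k => ?_, fun k₀ h₀ k hk => ?_, ?_⟩
  · have : Quotient.mk S (τ p k) = Quotient.mk S k :=
      Quotient.sound (S.symm (Relation.EqvGen.rel _ _ ⟨p, rfl⟩))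
    simp only [f, this]
  · let T : Setoid κ := ⟨fun a b => a = k₀ ↔ b = k₀, ⟨fun _ => Iff.rfl, Iff.symm, Iff.trans⟩⟩
    have hle : S ≤ T := Setoid.eqvGen_le fun a b ⟨p, hp⟩ => by
      change a = k₀ ↔ b = k₀
      rw [← hp]
      constructor
      · rintro rfl; exact h₀ p
      · intro h; exact (τ p).injective (h.trans (h₀ p).symm)
    exact (hle (hS k k₀ hk)).2 rfl
  · let Φ : (ι → κ → G) →+ (κ → G) :=
      { toFun := fun w k => ∑ p, w p k - ∑ p, w p (τ p k)
        map_zero' := by ext; simp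
        map_add' := fun w w' => by ext; simp [sum_add_distrib]; abel }
    have hsingle : ∀ k l, S k l → ∀ g : G, Pi.single k g - Pi.single l g ∈ Φ.range := by
      let T : Setoid κ := ⟨fun k l => ∀ g : G, Pi.single k g - Pi.single l g ∈ Φ.range,
        ⟨fun k g => by simp, fun {k l} h g => by
          rw [← neg_sub]; exact neg_mem (h g),
         fun {k l m} h h' g => by
          rw [← sub_add_sub_cancel _ (Pi.single l g)]; exact add_mem (h g) (h' g)⟩⟩
      have hle : S ≤ T := Setoid.eqvGen_le fun k l ⟨p, hp⟩ => by
        intro g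
        rw [← neg_sub]
        refine neg_mem ⟨Pi.single p (Pi.single l g), ?_⟩
        ext m
        change ∑ q, (Pi.single p (Pi.single l g) : ι → κ → G) q m -
          ∑ q, (Pi.single p (Pi.single l g) : ι → κ → G) q (τ q m) = _
        rw [sum_eq_single p (by intro q _ hq; simp [hq]) (by simp),
          sum_eq_single p (by intro q _ hq; simp [hq]) (by simp)]
        have : τ p m = l ↔ m = k := by rw [← hp]; exact (τ p).injective.eq_iff
        simp [Pi.single_apply, this]
      exact hle
    have hker : #{w : ι → κ → G | ∀ k, ∑ p, w p k = ∑ p, w p (τ p k)} = Nat.card Φ.ker := by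
      rw [← Fintype.card_subtype, ← Nat.card_eq_fintype_card]
      refine Nat.card_congr (Equiv.subtypeEquivRight fun w => ?_)
      rw [AddMonoidHom.mem_ker, funext_iff]
      exact forall_congr' fun k => sub_eq_zero.symm
    have hrange : Fintype.card G ^ (∑ i, (#{k | f k = i} - 1)) ≤ Nat.card Φ.range := by
      rw [sum_card_fiber_sub_one hff, ← Fintype.card_subtype, ← Fintype.card_fun,
        ← Nat.card_eq_fintype_card]
      let Ψ : ({k // f k ≠ k} → G) → Φ.range := fun g =>
        ⟨∑ k : {k // f k ≠ k}, (Pi.single (k : κ) (g k) - Pi.single (f k) (g k)),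
          sum_mem fun k _ => hsingle _ _ (S.symm (hfS k)) _⟩
      refine Nat.card_le_card_of_injective Ψ fun g g' h => ?_
      have hval : ∀ g k, (Ψ g : κ → G) (k : {k // f k ≠ k}) = g k := by
        intro g k
        simp only [Ψ, Finset.sum_apply, Pi.sub_apply]
        rw [sum_eq_single k]
        · rw [Pi.single_eq_same, Pi.single_eq_of_ne k.2.symm, sub_zero]
        · intro l _ hl
          have h2 : (k : κ) ≠ f l := fun h => k.2 (by rw [h, hff])
          rw [Pi.single_eq_of_ne (fun h => hl (Subtype.ext h.symm)), Pi.single_eq_of_ne h2,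
            sub_zero]
        · simp
      ext k
      rw [← hval g k, ← hval g' k, h]
    rw [hker]
    calc _ ≤ Nat.card Φ.ker * Nat.card Φ.range := Nat.mul_le_mul_left _ hrange
      _ = Nat.card (ι → κ → G) := by
        rw [← AddSubgroup.index_ker, AddSubgroup.card_mul_index]
      _ = _ := by simp [← pow_mul, mul_comm]

open Finset Nat in
/-- Summed over all non-identity tuples `τ` with a common fixed point, the numbers of solutions of
the systems `∑ p, w p k = ∑ p, w p (τ p k)` are small compared with the number of all `w`. -/
lemma sum_card_solutions_le {G : Type*} [AddCommGroup G] [Fintype G] [DecidableEq G] {t n K : ℕ}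
    (hK : 1 ≤ K)
    (hG : ∀ s, 2 ≤ s → s + 1 ≤ t → K * (s !) ^ n ≤ Fintype.card G ^ (s - 1)) :
    K * ∑ τ : Fin n → Equiv.Perm (Fin t) with τ ≠ 1 ∧ ∃ k₀, ∀ p, τ p k₀ = k₀,
        #{w : Fin n → Fin t → G | ∀ k, ∑ p, w p k = ∑ p, w p (τ p k)} ≤
      t ^ t * Fintype.card G ^ (n * t) := by
  choose f hfτ hfix hcard using fun τ : Fin n → Equiv.Perm (Fin t) =>
    exists_orbit_representative (G := G) τ
  set M := Fintype.card G with hM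
  have hMpos : 0 < M := Fintype.card_pos
  rw [← sum_fiberwise _ f, mul_sum]
  have hbound : ∀ ρ : Fin t → Fin t,
      K * ∑ τ ∈ ({τ : Fin n → Equiv.Perm (Fin t) | τ ≠ 1 ∧ ∃ k₀, ∀ p, τ p k₀ = k₀} : Finset _)
          with f τ = ρ,
        #{w : Fin n → Fin t → G | ∀ k, ∑ p, w p k = ∑ p, w p (τ p k)} ≤ M ^ (n * t) := by
    intro ρ
    set Tρ := ({τ ∈ ({τ : Fin n → Equiv.Perm (Fin t) | τ ≠ 1 ∧ ∃ k₀, ∀ p, τ p k₀ = k₀} : Finset _)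
          | f τ = ρ}) with hTρ
    rcases Tρ.eq_empty_or_nonempty with h0 | ⟨τ₀, hτ₀⟩
    · rw [h0]; simp
    obtain ⟨⟨hne, k₀, hk₀⟩, rfl⟩ : (τ₀ ≠ 1 ∧ ∃ k₀, ∀ p, τ₀ p k₀ = k₀) ∧ f τ₀ = ρ := by
      simpa [hTρ] using hτ₀
    set ρ := f τ₀ with hρ
    set s : Fin t → ℕ := fun i => #{k | ρ k = i} with hs
    have hTcard : #Tρ ≤ (∏ i, (s i)!) ^ n := by
      have hsub : Tρ ⊆ Fintype.piFinset fun _ : Fin n =>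
          ({g : Equiv.Perm (Fin t) | ρ ∘ g = ρ} : Finset _) := by
        intro τ hτ
        have hτ' : f τ = ρ := (mem_filter.1 hτ).2
        rw [Fintype.mem_piFinset]
        intro p
        rw [mem_filter]
        exact ⟨mem_univ _, funext fun k => by rw [← hτ']; exact hfτ τ p k⟩
      refine (card_le_card hsub).trans ?_
      rw [Fintype.card_piFinset_const, ← Fintype.card_subtype, DomMulAct.stabilizer_card]
      simp only [Fintype.card_subtype]
      exact le_rfl
    -- the fibre of a common fixed point is a singleton, so no fibre has all `t` points
    have hslt : ∀ i, 2 ≤ s i → s i + 1 ≤ t := by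
      intro i hi
      have : ({k | ρ k = i} : Finset (Fin t)) ⊆ univ.erase k₀ := by
        intro k hk
        rw [mem_erase]
        refine ⟨?_, mem_univ _⟩
        rintro rfl
        have h1 : s i ≤ 1 := by
          refine card_le_one.2 fun a ha b hb => ?_
          have hk' := (mem_filter.1 hk).2
          rw [hfix τ₀ k hk₀ a ((mem_filter.1 ha).2.trans hk'.symm),
            hfix τ₀ k hk₀ b ((mem_filter.1 hb).2.trans hk'.symm)]
        omega
      have h2 := card_le_card this
      rw [card_erase_of_mem (mem_univ _), Finset.card_univ, Fintype.card_fin] at h2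
      have := k₀.pos
      simp only [hs] at *
      omega
    have hle : ∀ i, (s i)! ^ n ≤ M ^ (s i - 1) := by
      intro i
      rcases Nat.lt_or_ge (s i) 2 with h | h
      · have : (s i)! = 1 := Nat.factorial_eq_one.2 (by omega)
        rw [this, one_pow]; exact Nat.one_le_pow _ _ hMpos
      · exact (Nat.le_mul_of_pos_left _ hK).trans (hG _ h (hslt i h))
    obtain ⟨i₀, hi₀⟩ : ∃ i, 2 ≤ s i := by
      obtain ⟨p, hp⟩ := Function.ne_iff.1 hne
      obtain ⟨k, hk⟩ : ∃ k, τ₀ p k ≠ k := by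
        by_contra! h; exact hp (Equiv.ext h)
      exact ⟨ρ k, one_lt_card.2 ⟨τ₀ p k, by simp [hρ, hfτ], k, by simp, hk⟩⟩
    have hprod : K * (∏ i, (s i)!) ^ n ≤ M ^ (∑ i, (s i - 1)) := by
      rw [← prod_pow, ← prod_pow_eq_pow_sum, ← mul_prod_erase _ _ (mem_univ i₀),
        ← mul_prod_erase _ (fun i => M ^ (s i - 1)) (mem_univ i₀), ← mul_assoc]
      exact Nat.mul_le_mul (hG _ hi₀ (hslt _ hi₀)) (prod_le_prod' fun i _ => hle i)
    have hA : 0 < M ^ (∑ i, (s i - 1)) := pow_pos hMpos _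
    refine Nat.le_of_mul_le_mul_right ?_ hA
    calc (K * ∑ τ ∈ Tρ, #{w : Fin n → Fin t → G | ∀ k, ∑ p, w p k = ∑ p, w p (τ p k)}) *
          M ^ (∑ i, (s i - 1))
        = K * ∑ τ ∈ Tρ, #{w : Fin n → Fin t → G | ∀ k, ∑ p, w p k = ∑ p, w p (τ p k)} *
          M ^ (∑ i, (s i - 1)) := by rw [mul_assoc, sum_mul]
      _ ≤ K * ∑ τ ∈ Tρ, M ^ (n * t) := by
          refine Nat.mul_le_mul_left _ (sum_le_sum fun τ hτ => ?_)
          have h := hcard τ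
          rw [(mem_filter.1 hτ).2, Fintype.card_fin, Fintype.card_fin] at h
          refine le_trans (le_of_eq ?_) h
          congr!
      _ = K * #Tρ * M ^ (n * t) := by rw [sum_const, smul_eq_mul, mul_assoc]
      _ ≤ K * (∏ i, (s i)!) ^ n * M ^ (n * t) := by gcongr
      _ ≤ M ^ (∑ i, (s i - 1)) * M ^ (n * t) := by gcongr
      _ = _ := mul_comm _ _
  refine (sum_le_sum fun ρ _ => hbound ρ).trans ?_
  simp

/-! ### Hashing tuples of permutations -/

/-- A tuple `x` of permutations of `Fin (u + 1)` stands for the perfect matching whose edge in slot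
`k` is `p ↦ x p k`. The hash of an edge in slot `k < u` is `c k + ∑ p, w p (x p k)`; the tuple is
hashed to `b` if these `u` edges have hash `b`. The last slot needs no condition, since the sum of
`w p (x p k)` over all `p` and `k` does not depend on `x`. -/
def IsHashed {G : Type*} [AddCommGroup G] {n u : ℕ} (w : Fin n → Fin (u + 1) → G) (c : Fin u → G)
    (b : G) (x : Fin n → Equiv.Perm (Fin (u + 1))) : Prop :=
  ∀ k : Fin u, c k + ∑ p, w p (x p k.castSucc) = b

open Classical in
/-- The pairs `(b, x)` with `b ∈ B` such that `x` is hashed to `b` and no other tuple hashed to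
`b` has an edge in common with `x`. -/
noncomputable def isolatedTuples {G : Type*} [AddCommGroup G] [Fintype G] {n u : ℕ}
    (w : Fin n → Fin (u + 1) → G) (c : Fin u → G) (B : Finset G) :
    Finset (G × (Fin n → Equiv.Perm (Fin (u + 1)))) :=
  {a ∈ B ×ˢ Finset.univ | IsHashed w c a.1 a.2 ∧
    ∀ y, IsHashed w c a.1 y → (∃ k, ∀ p, y p k = a.2 p k) → y = a.2}

lemma sum_sum_perm {G : Type*} [AddCommGroup G] {n t : ℕ} (w : Fin n → Fin t → G)
    (x : Fin n → Equiv.Perm (Fin t)) :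
    ∑ k, ∑ p, w p (x p k) = ∑ p, ∑ k, w p k := by
  rw [Finset.sum_comm]
  exact Finset.sum_congr rfl fun p _ => Equiv.sum_comp (x p) (w p)

/-- If the edges of a tuple `y` are taken from isolated tuples, slot by slot, then these isolated
tuples all coincide, provided `B` has only trivial solutions of `b₁ + ⋯ + b_u = u b`. -/
lemma eq_of_mem_isolatedTuples {G : Type*} [AddCommGroup G] [Fintype G] {n u : ℕ}
    {w : Fin n → Fin (u + 1) → G} {c : Fin u → G} {B : Finset G}
    (hB : ∀ (b : Fin u → G) (b' : G), (∀ k, b k ∈ B) → b' ∈ B → ∑ k, b k = u • b' → ∀ k, b k = b')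
    (z : Fin (u + 1) → G × (Fin n → Equiv.Perm (Fin (u + 1))))
    (hz : ∀ k, z k ∈ isolatedTuples w c B) (y : Fin n → Equiv.Perm (Fin (u + 1)))
    (hy : ∀ k p, y p k = (z k).2 p k) (k l : Fin (u + 1)) : z k = z l := by
  simp only [isolatedTuples, Finset.mem_filter, Finset.mem_product, Finset.mem_univ,
    and_true] at hz
  have hyk : ∀ k : Fin u, c k + ∑ p, w p (y p k.castSucc) = (z k.castSucc).1 := fun k => by
    simp_rw [hy]; exact (hz k.castSucc).2.1 k
  have hlast : ∀ x : Fin n → Equiv.Perm (Fin (u + 1)),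
      ∑ k : Fin u, (c k + ∑ p, w p (x p k.castSucc)) + ∑ p, w p (x p (Fin.last u)) =
        ∑ k, c k + ∑ p, ∑ k, w p k := by
    intro x
    rw [← sum_sum_perm w x, Fin.sum_univ_castSucc, Finset.sum_add_distrib, add_assoc]
  have hsum : ∑ k : Fin u, (z k.castSucc).1 = u • (z (Fin.last u)).1 := by
    have h1 := hlast y
    rw [← hlast (z (Fin.last u)).2] at h1
    simp_rw [hy (Fin.last u)] at h1
    have h2 := add_right_cancel h1
    simp_rw [hyk, (hz (Fin.last u)).2.1 _] at h2
    simpa using h2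
  have hb : ∀ k, (z k).1 = (z (Fin.last u)).1 := by
    intro k
    refine Fin.lastCases rfl (fun k => ?_) k
    exact hB (fun k => (z k.castSucc).1) _ (fun k => (hz _).1) (hz _).1 hsum k
  have hyH : ∀ k, IsHashed w c (z k).1 y := fun k l => by rw [hyk, hb, hb k]
  have hall : ∀ k, z k = ((z (Fin.last u)).1, y) := fun k =>
    Prod.ext (hb k) ((hz k).2.2 y (hyH k) ⟨k, hy k⟩).symm
  rw [hall k, hall l]

open Finset Classical in
/-- First moment computation: an average choice of `w` and `c` isolates at least half of the
expected number of hashed tuples. -/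
lemma exists_card_isolatedTuples_ge {G : Type*} [AddCommGroup G] [Fintype G] (n u : ℕ)
    (B : Finset G)
    (hG : 2 * ∑ τ : Fin n → Equiv.Perm (Fin (u + 1)) with τ ≠ 1 ∧ ∃ k₀, ∀ p, τ p k₀ = k₀,
        #{w : Fin n → Fin (u + 1) → G | ∀ k, ∑ p, w p k = ∑ p, w p (τ p k)} ≤
      Fintype.card G ^ (n * (u + 1))) :
    ∃ (w : Fin n → Fin (u + 1) → G) (c : Fin u → G),
      #B * (u + 1).factorial ^ n ≤ 2 * Fintype.card G ^ u * #(isolatedTuples w c B) := by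
  set M := Fintype.card G
  have hWcard : Fintype.card (Fin n → Fin (u + 1) → G) = M ^ (n * (u + 1)) := by
    simp [M, ← pow_mul, mul_comm]
  have hpair : ∀ a ∈ B ×ˢ (univ : Finset (Fin n → Equiv.Perm (Fin (u + 1)))),
      M ^ (n * (u + 1)) ≤ 2 * #{ω : (Fin n → Fin (u + 1) → G) × (Fin u → G) |
        a ∈ isolatedTuples ω.1 ω.2 B} := by
    rintro ⟨b, x⟩ hbx
    -- the shift `c` for which a given `w` hashes `x` to `b`
    set γ : (Fin n → Fin (u + 1) → G) → Fin u → G :=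
      fun w k => b - ∑ p, w p (x p k.castSucc) with hγ
    set bad : Finset (Fin n → Equiv.Perm (Fin (u + 1))) :=
      {y | y ≠ x ∧ ∃ k, ∀ p, y p k = x p k} with hbad
    have hsplit : (univ : Finset (Fin n → Fin (u + 1) → G)) ⊆
        ({w | (b, x) ∈ isolatedTuples w (γ w) B} : Finset _) ∪
        bad.biUnion fun y => {w | ∀ k, ∑ p, w p (x p k) = ∑ p, w p (y p k)} := by
      intro w _
      by_contra hcon
      rw [mem_union, not_or] at hcon
      refine hcon.1 ?_
      rw [mem_filter]
      refine ⟨mem_univ _, ?_⟩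
      rw [isolatedTuples, mem_filter]
      refine ⟨hbx, fun k => by simp [γ], fun y hy hk => ?_⟩
      by_contra hne
      refine hcon.2 (mem_biUnion.2 ⟨y, by simpa [bad] using ⟨hne, hk⟩, ?_⟩)
      rw [mem_filter]
      refine ⟨mem_univ _, ?_⟩
      have h1 : ∀ k : Fin u, ∑ p, w p (x p k.castSucc) = ∑ p, w p (y p k.castSucc) := by
        intro k
        have := hy k
        simp only [γ] at this
        rw [sub_add, sub_eq_self, sub_eq_zero] at this
        exact this
      intro k
      refine Fin.lastCases ?_ h1 k
      have h2 := (sum_sum_perm w x).trans (sum_sum_perm w y).symm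
      rw [Fin.sum_univ_castSucc, Fin.sum_univ_castSucc (n := u)] at h2
      simp_rw [h1] at h2
      exact add_left_cancel h2
    have hle1 : #({w | (b, x) ∈ isolatedTuples w (γ w) B} : Finset (Fin n → Fin (u + 1) → G)) ≤
        #{ω : (Fin n → Fin (u + 1) → G) × (Fin u → G) | (b, x) ∈ isolatedTuples ω.1 ω.2 B} :=
      card_le_card_of_injOn (fun w => (w, γ w)) (fun w hw => by simpa using hw)
        (fun w _ w' _ h => congrArg Prod.fst h)
    have hle2 : 2 * ∑ y ∈ bad, #({w | ∀ k, ∑ p, w p (x p k) = ∑ p, w p (y p k)} :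
        Finset (Fin n → Fin (u + 1) → G)) ≤ M ^ (n * (u + 1)) := by
      refine le_trans (le_of_eq ?_) hG
      congr 1
      refine sum_equiv (Equiv.mulLeft x⁻¹) (fun y => ?_) (fun y _ => ?_)
      · simp only [bad, mem_filter, mem_univ, true_and, Equiv.coe_mulLeft, ne_eq,
          inv_mul_eq_one, Pi.mul_apply, Pi.inv_apply, Equiv.Perm.mul_apply,
          Equiv.Perm.inv_eq_iff_eq, eq_comm (a := x)]
      · refine card_equiv (Equiv.piCongrRight fun p => (x p).symm.arrowCongr (Equiv.refl G))
          fun w => ?_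
        rw [mem_filter, mem_filter]
        simp [Equiv.arrowCongr, Pi.map]
    have h3 := (card_le_card hsplit).trans (card_union_le _ _)
    rw [Finset.card_univ, hWcard] at h3
    have h4 := card_biUnion_le (s := bad) (t := fun y =>
      ({w | ∀ k, ∑ p, w p (x p k) = ∑ p, w p (y p k)} : Finset (Fin n → Fin (u + 1) → G)))
    omega
  by_contra! hcon
  have hdouble := sum_card_bipartiteAbove_eq_sum_card_bipartiteBelow
    (s := B ×ˢ (univ : Finset (Fin n → Equiv.Perm (Fin (u + 1)))))
    (t := (univ : Finset ((Fin n → Fin (u + 1) → G) × (Fin u → G))))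
    (fun a ω => a ∈ isolatedTuples ω.1 ω.2 B)
  have h1 : #B * (u + 1).factorial ^ n * M ^ (n * (u + 1)) ≤
      2 * ∑ ω : (Fin n → Fin (u + 1) → G) × (Fin u → G), #(isolatedTuples ω.1 ω.2 B) := by
    calc #B * (u + 1).factorial ^ n * M ^ (n * (u + 1))
        = ∑ a ∈ B ×ˢ (univ : Finset (Fin n → Equiv.Perm (Fin (u + 1)))), M ^ (n * (u + 1)) := by
          simp [card_product, Fintype.card_perm]
      _ ≤ _ := sum_le_sum hpair
      _ = 2 * ∑ ω : (Fin n → Fin (u + 1) → G) × (Fin u → G),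
            #{a ∈ B ×ˢ (univ : Finset (Fin n → Equiv.Perm (Fin (u + 1)))) |
              a ∈ isolatedTuples ω.1 ω.2 B} := by
          rw [← mul_sum]; exact congrArg (2 * ·) hdouble
      _ ≤ _ := by
          gcongr with ω
          intro a ha
          exact (mem_filter.1 ha).2
  have h2 : 2 * M ^ u * ∑ ω : (Fin n → Fin (u + 1) → G) × (Fin u → G),
      #(isolatedTuples ω.1 ω.2 B) <
        M ^ (n * (u + 1)) * M ^ u * (#B * (u + 1).factorial ^ n) := by
    rw [mul_sum]
    refine (sum_lt_sum_of_nonempty univ_nonempty fun ω _ => hcon ω.1 ω.2).trans_le ?_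
    rw [sum_const, smul_eq_mul, Finset.card_univ, Fintype.card_prod, hWcard]
    simp [M]
  have h3 := Nat.mul_le_mul_left (M ^ u) h1
  nlinarith

/-! ### A Behrend-type set in `(ℤ/q)^m` -/

open Finset in
/-- Vectors with small digits on a common sphere: sums of `u` of them do not wrap around modulo
`q`, and by strict convexity the average of `u` points of a sphere lies on that sphere only if the
points coincide. -/
lemma exists_large_sphere (u m q : ℕ) (hm : 1 ≤ m) (hq : 1 ≤ q) :
    ∃ B : Finset (Fin m → ZMod q),
      (∀ (b : Fin u → Fin m → ZMod q) (b' : Fin m → ZMod q), (∀ k, b k ∈ B) → b' ∈ B →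
        ∑ k, b k = u • b' → ∀ k, b k = b') ∧
      q ^ m ≤ #B * ((u + 1) ^ m * (m * q ^ 2)) := by
  set l := (q - 1) / (u + 1) with hl
  have hul : u * l < q := by
    have h1 : (u + 1) * l ≤ q - 1 := Nat.mul_div_le _ _
    have h2 : u * l ≤ (u + 1) * l := Nat.mul_le_mul_right _ (by omega)
    omega
  have hlq : l < q := by
    have := Nat.div_le_self (q - 1) (u + 1)
    omega
  have hqL : q ≤ (u + 1) * (l + 1) := by
    have := Nat.lt_mul_div_succ (q - 1) (Nat.succ_pos u)
    simp only [Nat.succ_eq_add_one] at this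
    rw [← hl] at this
    omega
  set norm : (Fin m → Fin (l + 1)) → ℕ := fun d => ∑ i, (d i : ℕ) ^ 2 with hnorm
  have hmaps : ∀ d, norm d ∈ range (m * q ^ 2) := by
    intro d
    rw [mem_range]
    have : Nonempty (Fin m) := ⟨⟨0, hm⟩⟩
    calc norm d < ∑ _i : Fin m, q ^ 2 := sum_lt_sum_of_nonempty univ_nonempty fun i _ =>
          Nat.pow_lt_pow_left (by have := (d i).2; omega) two_ne_zero
      _ = m * q ^ 2 := by simp
  obtain ⟨ν, hν⟩ : ∃ ν, (l + 1) ^ m ≤ m * q ^ 2 * #{d | norm d = ν} := by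
    by_contra! hcon
    have h1 := card_eq_sum_card_fiberwise (s := univ) (f := norm) (t := range (m * q ^ 2))
      (fun d _ => by simpa using hmaps d)
    have hne : (range (m * q ^ 2)).Nonempty := ⟨0, mem_range.2 (by positivity)⟩
    have h2 := sum_lt_sum_of_nonempty hne fun ν _ => hcon ν
    rw [← mul_sum, ← h1] at h2
    simp at h2
  set cst : (Fin m → Fin (l + 1)) → Fin m → ZMod q := fun d i => ((d i : ℕ) : ZMod q) with hcst
  have hcstinj : Function.Injective cst := by
    intro d d' h
    ext i
    have := congrFun h i
    simp only [cst] at this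
    rw [ZMod.natCast_eq_natCast_iff'] at this
    rwa [Nat.mod_eq_of_lt (by have := (d i).2; omega),
      Nat.mod_eq_of_lt (by have := (d' i).2; omega)] at this
  refine ⟨({d | norm d = ν} : Finset _).image cst, ?_, ?_⟩
  · intro b b' hb hb' hsum k
    have hex : ∀ k, ∃ d, norm d = ν ∧ cst d = b k := fun k => by simpa using hb k
    choose d hd hdb using hex
    obtain ⟨d', hd', rfl⟩ : ∃ d, norm d = ν ∧ cst d = b' := by simpa using hb'
    have hcoord : ∀ i, ∑ k, (d k i : ℕ) = u * (d' i : ℕ) := by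
      intro i
      have h := congrFun hsum i
      simp only [Finset.sum_apply, ← hdb, cst, Pi.smul_apply, nsmul_eq_mul] at h
      norm_cast at h
      rw [ZMod.natCast_eq_natCast_iff'] at h
      have h1 : ∑ k, (d k i : ℕ) ≤ u * l := by
        refine (sum_le_card_nsmul univ _ l fun k _ => ?_).trans (by simp)
        have := (d k i).2; omega
      have h2 : u * (d' i : ℕ) ≤ u * l := Nat.mul_le_mul_left _ (by have := (d' i).2; omega)
      rwa [Nat.mod_eq_of_lt (by omega), Nat.mod_eq_of_lt (by omega)] at h
    have hnorm' : ∀ d, norm d = ν → ∑ i, ((d i : ℕ) : ℤ) ^ 2 = ν := fun d h => by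
      rw [← h]; simp [norm]
    have hzero : ∑ k, ∑ i, (((d k i : ℕ) : ℤ) - ((d' i : ℕ) : ℤ)) ^ 2 = 0 := by
      have h1 : ∑ k, ∑ i, ((d k i : ℕ) : ℤ) * ((d' i : ℕ) : ℤ) = u * ν := by
        rw [sum_comm, ← hnorm' d' hd', mul_sum]
        refine sum_congr rfl fun i _ => ?_
        rw [← sum_mul]
        have := congrArg (Nat.cast : ℕ → ℤ) (hcoord i)
        push_cast at this
        rw [this]; ring
      simp_rw [sub_sq, sum_add_distrib, sum_sub_distrib, mul_assoc, ← mul_sum, h1,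
        hnorm' _ (hd _), hnorm' _ hd']
      simp
      ring
    have hz : ∀ i, (d k i : ℕ) = d' i := by
      intro i
      have h1 := (sum_eq_zero_iff_of_nonneg fun k _ =>
        sum_nonneg fun i _ => sq_nonneg (((d k i : ℕ) : ℤ) - ((d' i : ℕ) : ℤ))).1 hzero k
          (mem_univ _)
      have h2 := (sum_eq_zero_iff_of_nonneg fun i _ => sq_nonneg _).1 h1 i (mem_univ _)
      have h3 := pow_eq_zero_iff two_ne_zero |>.1 h2
      omega
    rw [← hdb k]
    ext i
    simp [cst, hz]
  · rw [card_image_of_injective _ hcstinj]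
    calc q ^ m ≤ ((u + 1) * (l + 1)) ^ m := Nat.pow_le_pow_left hqL _
      _ = (u + 1) ^ m * (l + 1) ^ m := mul_pow _ _ _
      _ ≤ (u + 1) ^ m * (m * q ^ 2 * #{d | norm d = ν}) := Nat.mul_le_mul_left _ hν
      _ = _ := by ring

/-! ### Choice of the modulus -/

open scoped Nat in
lemma factorial_pow_le_factorial_pow {v a : ℕ} (h : v ≤ a) :
    ((v + 1)!) ^ a ≤ ((a + 1)!) ^ v := by
  have hfac : ∀ v : ℕ, (v + 1)! ≤ (v + 1) ^ v := by
    intro v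
    induction v with
    | zero => simp
    | succ v ih =>
      rw [Nat.factorial_succ, pow_succ']
      exact Nat.mul_le_mul_left _ (ih.trans (Nat.pow_le_pow_left (by omega) _))
  induction a, h using Nat.le_induction with
  | base => exact le_rfl
  | succ a hva ih =>
    have h1 : (v + 1)! ≤ (a + 2) ^ v := (hfac v).trans (Nat.pow_le_pow_left (by omega) _)
    calc ((v + 1)!) ^ (a + 1) = ((v + 1)!) ^ a * (v + 1)! := pow_succ _ _
      _ ≤ ((a + 1)!) ^ v * (a + 2) ^ v := Nat.mul_le_mul ih h1
      _ = ((a + 2) * (a + 1)!) ^ v := by rw [mul_pow, mul_comm]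
      _ = _ := by rw [← Nat.factorial_succ]

open scoped Nat in
/-- The modulus `q` is the least one with `K ^ a * (a + 1)! ^ n ≤ q ^ (m * a)`; up to a factor
exponential in `m` this is an equality. -/
lemma exists_modulus (a m n K : ℕ) (hm : 1 ≤ m) (hK : 1 ≤ K) (hn : n ≤ m * m) :
    ∃ q, 1 ≤ q ∧ K ^ a * (a + 1)! ^ n ≤ q ^ (m * a) ∧
      q ^ (m * a) ≤ 2 ^ (m * a) * (K ^ a * (a + 1)! ^ n) ∧
      q ≤ 2 ^ a * K ^ a * (a + 1)! ^ m := by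
  have hpos : 0 < (a + 1)! := Nat.factorial_pos _
  rcases Nat.eq_zero_or_pos a with rfl | ha
  · exact ⟨1, le_rfl, by simp, by simp, by simp⟩
  have hma : m * a ≠ 0 := (Nat.mul_pos hm ha).ne'
  set X := K ^ a * (a + 1)! ^ n with hX
  have hX1 : 1 ≤ X := Nat.mul_pos (pow_pos hK _) (pow_pos hpos _)
  have hex : ∃ q, X ≤ q ^ (m * a) := ⟨X, Nat.le_self_pow hma X⟩
  set q := Nat.find hex with hq
  have hspec : X ≤ q ^ (m * a) := Nat.find_spec hex
  have hq1 : 1 ≤ q := by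
    rw [Nat.one_le_iff_ne_zero]
    intro h
    rw [h, zero_pow hma] at hspec
    omega
  have hup : q ^ (m * a) ≤ 2 ^ (m * a) * X := by
    rcases Nat.lt_or_ge q 2 with h | h
    · have : q = 1 := by omega
      rw [this, one_pow]
      exact Nat.mul_pos (by positivity) hX1
    · have hmin : (q - 1) ^ (m * a) < X := not_le.1 (Nat.find_min hex (by omega))
      calc q ^ (m * a) ≤ (2 * (q - 1)) ^ (m * a) := Nat.pow_le_pow_left (by omega) _
        _ = 2 ^ (m * a) * (q - 1) ^ (m * a) := mul_pow _ _ _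
        _ ≤ _ := Nat.mul_le_mul_left _ hmin.le
  refine ⟨q, hq1, hspec, hup, ?_⟩
  refine (Nat.pow_le_pow_iff_left (n := m) (by omega)).1 ?_
  calc q ^ m ≤ q ^ (m * a) := Nat.pow_le_pow_right hq1 (Nat.le_mul_of_pos_right _ ha)
    _ ≤ 2 ^ (m * a) * (K ^ a * (a + 1)! ^ n) := hup
    _ ≤ 2 ^ (m * a) * ((K ^ a) ^ m * (a + 1)! ^ (m * m)) := by
        exact Nat.mul_le_mul_left _ (Nat.mul_le_mul (Nat.le_self_pow (by omega) _)
          (Nat.pow_le_pow_right hpos hn))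
    _ = _ := by ring

open scoped Nat in
/-- There are `t ^ r / C ^ √r` tuples of permutations (perfect matchings whose edges are tagged by
a slot) such that a perfect matching using their edges slot by slot is one of them. -/
lemma exists_many_tuples (t : ℕ) (ht : 2 ≤ t) :
    ∃ C : ℕ, 1 ≤ C ∧ ∀ n m : ℕ, 1 ≤ m → n ≤ m * m →
      ∃ (N : ℕ) (Z : Fin N → Fin n → Equiv.Perm (Fin t)), t ^ (n + 1) ≤ N * C ^ m ∧
        ∀ (j : Fin t → Fin N) (y : Fin n → Equiv.Perm (Fin t)),
          (∀ k p, y p k = Z (j k) p k) → ∀ k l, j k = j l := by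
  obtain ⟨a, rfl⟩ : ∃ a, t = a + 2 := ⟨t - 2, by omega⟩
  set t := a + 2 with hta
  set K := 2 * t ^ t with hK
  have hK1 : 1 ≤ K := Nat.succ_le_of_lt (by positivity)
  set A := 2 ^ a * K ^ a with hA
  have hA1 : 1 ≤ A := Nat.succ_le_of_lt (by positivity)
  refine ⟨t * (4 * A * t * (A * (a + 1)!) ^ 2), Nat.succ_le_of_lt (by positivity), fun n m hm hn => ?_⟩
  obtain ⟨q, hq1, hq2, hq3, hq4⟩ := exists_modulus a m n K hm hK1 hn
  have : NeZero q := ⟨by omega⟩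
  obtain ⟨B, hB, hBcard⟩ := exists_large_sphere (a + 1) m q hm hq1
  have hMcard : Fintype.card (Fin m → ZMod q) = q ^ m := by simp [ZMod.card]
  have hG : ∀ s, 2 ≤ s → s + 1 ≤ t → K * s ! ^ n ≤ Fintype.card (Fin m → ZMod q) ^ (s - 1) := by
    intro s hs hst
    rw [hMcard]
    obtain ⟨v, rfl⟩ : ∃ v, s = v + 1 := ⟨s - 1, by omega⟩
    have hva : v ≤ a := by omega
    have hv1 : 1 ≤ v := by omega
    refine (Nat.pow_le_pow_iff_left (n := a) (by omega)).1 ?_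
    rw [Nat.add_sub_cancel]
    calc (K * (v + 1)! ^ n) ^ a = K ^ a * ((v + 1)! ^ a) ^ n := by
            rw [mul_pow, pow_right_comm]
      _ ≤ (K ^ a) ^ v * ((a + 1)! ^ v) ^ n := by
          exact Nat.mul_le_mul (Nat.le_self_pow (by omega) _)
            (Nat.pow_le_pow_left (factorial_pow_le_factorial_pow hva) _)
      _ = (K ^ a * (a + 1)! ^ n) ^ v := by ring
      _ ≤ (q ^ (m * a)) ^ v := Nat.pow_le_pow_left hq2 _
      _ = _ := by ring
  have hsum := sum_card_solutions_le (G := Fin m → ZMod q) (t := t) (n := n) hK1 hG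
  rw [hK, mul_comm 2, mul_assoc] at hsum
  have hsum' := Nat.le_of_mul_le_mul_left hsum (by positivity)
  obtain ⟨w, c, hwc⟩ := exists_card_isolatedTuples_ge n (a + 1) B
    (le_trans (le_of_eq (by congr!)) hsum')
  set X := isolatedTuples w c B with hX
  refine ⟨X.card, fun i p => (X.equivFin.symm i).1.2 p, ?_, ?_⟩
  · rw [hMcard] at hwc
    have hfac : (a + 1 + 1)! = t * (a + 1)! := Nat.factorial_succ _
    have h1 : t ^ n ≤ X.card * (2 * m * (2 ^ (m * a) * K ^ a * t ^ m * q ^ 2)) := by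
      have hpos : 0 < q ^ m * (a + 1)! ^ n := by positivity
      refine Nat.le_of_mul_le_mul_right ?_ hpos
      calc t ^ n * (q ^ m * (a + 1)! ^ n) = q ^ m * (a + 1 + 1)! ^ n := by
            rw [hfac, mul_pow, mul_left_comm]
        _ ≤ B.card * ((a + 1 + 1) ^ m * (m * q ^ 2)) * (a + 1 + 1)! ^ n := by gcongr
        _ = (B.card * (a + 1 + 1)! ^ n) * (t ^ m * (m * q ^ 2)) := by rw [hta]; ring
        _ ≤ (2 * (q ^ m) ^ (a + 1) * X.card) * (t ^ m * (m * q ^ 2)) := by gcongr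
        _ = q ^ (m * a) * (2 * q ^ m * X.card * (t ^ m * (m * q ^ 2))) := by ring
        _ ≤ (2 ^ (m * a) * (K ^ a * (a + 1)! ^ n)) *
              (2 * q ^ m * X.card * (t ^ m * (m * q ^ 2))) := by gcongr
        _ = _ := by ring
    have h2 : 2 * m ≤ 4 ^ m := by
      calc 2 * m ≤ 2 ^ m * 2 ^ m :=
            Nat.mul_le_mul (Nat.le_self_pow (by omega) _) Nat.lt_two_pow_self.le
        _ = 4 ^ m := by rw [← mul_pow]; norm_num
    have h3 : K ^ a ≤ (K ^ a) ^ m := Nat.le_self_pow (by omega) _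
    have h4 : A ≤ A ^ m := Nat.le_self_pow (by omega) _
    have h5 : t ≤ t ^ m := Nat.le_self_pow (by omega) _
    calc t ^ (n + 1) = t ^ n * t := pow_succ _ _
      _ ≤ X.card * (2 * m * (2 ^ (m * a) * K ^ a * t ^ m * q ^ 2)) * t := by gcongr
      _ ≤ X.card * (4 ^ m * (2 ^ (m * a) * (K ^ a) ^ m * t ^ m *
            (A ^ m * (a + 1)! ^ m) ^ 2)) * t ^ m := by
          gcongr
          exact hq4.trans (by gcongr)
      _ = _ := by
          have hAm : A ^ m = 2 ^ (m * a) * (K ^ a) ^ m := by rw [hA, mul_pow, ← pow_mul, mul_comm a]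
          rw [← hAm]
          clear_value A t
          generalize (a + 1)! = F
          ring
  · intro j y hy k l
    have h := eq_of_mem_isolatedTuples hB (fun k => (X.equivFin.symm (j k)).1)
      (fun k => (X.equivFin.symm (j k)).2) y hy k l
    exact X.equivFin.symm.injective (Subtype.ext h)

/-! ### From tuples of permutations to perfect matchings -/

namespace RainbowMatching

/-- The graph of `e`, regarded as an edge with one vertex in each of the `r` parts
`{i} × Fin t`. -/
def graphEdge {r t : ℕ} (e : Fin r → Fin t) : Set (Fin r × Fin t) :=
  Set.range fun i => (i, e i)

lemma mem_graphEdge {r t : ℕ} {e : Fin r → Fin t} {v : Fin r × Fin t} :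
    v ∈ graphEdge e ↔ e v.1 = v.2 := by
  constructor
  · rintro ⟨i, rfl⟩; rfl
  · intro h; exact ⟨v.1, Prod.ext rfl h⟩

lemma disjoint_graphEdge {r t : ℕ} {e e' : Fin r → Fin t} :
    Disjoint (graphEdge e) (graphEdge e') ↔ ∀ i, e i ≠ e' i := by
  rw [Set.disjoint_left]
  constructor
  · intro h i hi
    exact h (a := (i, e i)) (mem_graphEdge.2 rfl) (mem_graphEdge.2 hi.symm)
  · intro h v hv hv'
    exact h v.1 ((mem_graphEdge.1 hv).trans (mem_graphEdge.1 hv').symm)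

/-- The complete `r`-partite `r`-uniform hypergraph with parts `{i} × Fin t`. -/
def completePartite (r t : ℕ) : Hypergraph (Fin r × Fin t) where
  vertexSet := Set.univ
  edgeSet := Set.range graphEdge
  subset_vertexSet_of_mem_edgeSet' := fun _ _ => Set.subset_univ _

lemma isUniform_completePartite (r t : ℕ) : IsUniform (completePartite r t) r := by
  rintro _ ⟨e, rfl⟩
  have hinj : Function.Injective fun i : Fin r => (i, e i) := fun i k h => congrArg Prod.fst h
  rw [graphEdge, ← Set.image_univ, hinj.encard_image, Set.encard_univ]
  simp

lemma isPartite_completePartite (r t : ℕ) : IsPartite (completePartite r t) r := by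
  refine ⟨fun i => {v | v.1 = i}, ?_, ?_, ?_⟩
  · ext v; simp [completePartite]
  · intro i k hik
    exact Set.disjoint_left.2 fun v hv hv' => hik (hv.symm.trans hv')
  · rintro _ ⟨e, rfl⟩ i
    refine ⟨(i, e i), ⟨mem_graphEdge.2 rfl, rfl⟩, ?_⟩
    rintro v ⟨hv, rfl⟩
    exact Prod.ext rfl (mem_graphEdge.1 hv).symm

/-- The edge in slot `k` of the perfect matching given by the tuple `x`. The first vertex records
the slot. -/
def slotEdge {n t : ℕ} (x : Fin n → Equiv.Perm (Fin t)) (k : Fin t) : Fin (n + 1) → Fin t :=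
  Fin.cons k fun p => x p k

open Classical in
/-- The perfect matching given by a tuple of permutations. -/
noncomputable def tupleMatching {n t : ℕ} (x : Fin n → Equiv.Perm (Fin t)) :
    Finset (Set (Fin (n + 1) × Fin t)) :=
  Finset.univ.image fun k => graphEdge (slotEdge x k)

lemma mem_tupleMatching {n t : ℕ} {x : Fin n → Equiv.Perm (Fin t)}
    {e : Set (Fin (n + 1) × Fin t)} :
    e ∈ tupleMatching x ↔ ∃ k, graphEdge (slotEdge x k) = e := by
  simp [tupleMatching]

lemma disjoint_slotEdge {n t : ℕ} (x : Fin n → Equiv.Perm (Fin t)) {k l : Fin t} (h : k ≠ l) :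
    Disjoint (graphEdge (slotEdge x k)) (graphEdge (slotEdge x l)) := by
  rw [disjoint_graphEdge]
  intro i
  refine Fin.cases ?_ (fun p => ?_) i
  · simpa [slotEdge] using h
  · simpa [slotEdge] using h

lemma isMatchingOfSize_tupleMatching {n t : ℕ} (x : Fin n → Equiv.Perm (Fin t)) :
    IsMatchingOfSize (completePartite (n + 1) t) t (tupleMatching x) := by
  refine ⟨?_, ?_, ?_⟩
  · intro e he
    obtain ⟨k, rfl⟩ := mem_tupleMatching.1 he
    exact ⟨_, rfl⟩
  · intro e he e' he' hne
    obtain ⟨k, rfl⟩ := mem_tupleMatching.1 he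
    obtain ⟨l, rfl⟩ := mem_tupleMatching.1 he'
    exact disjoint_slotEdge x fun h => hne (by rw [h])
  · rw [tupleMatching, Finset.card_image_of_injective, Finset.card_univ, Fintype.card_fin]
    intro k l hkl
    by_contra hne
    have h := disjoint_slotEdge x hne
    simp only at hkl
    rw [hkl, disjoint_graphEdge] at h
    exact h 0 rfl

lemma exists_mem_tupleMatching {n t : ℕ} (x : Fin n → Equiv.Perm (Fin t))
    (v : Fin (n + 1) × Fin t) : ∃ e ∈ tupleMatching x, v ∈ e := by
  obtain ⟨i, a⟩ := v
  refine Fin.cases ?_ (fun p => ?_) i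
  · exact ⟨_, mem_tupleMatching.2 ⟨a, rfl⟩, mem_graphEdge.2 rfl⟩
  · exact ⟨_, mem_tupleMatching.2 ⟨(x p).symm a, rfl⟩, mem_graphEdge.2 (by simp [slotEdge])⟩

/-- Pairwise disjoint edges of the matchings `tupleMatching (Z i)` occupy each slot exactly once,
so they are the edges of a single tuple of permutations. -/
lemma eq_of_pairwise_disjoint {n t N : ℕ} {Z : Fin N → Fin n → Equiv.Perm (Fin t)}
    (hZ : ∀ (j : Fin t → Fin N) (y : Fin n → Equiv.Perm (Fin t)),
      (∀ k p, y p k = Z (j k) p k) → ∀ k l, j k = j l)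
    (j : Fin t → Fin N) (e : Fin t → Set (Fin (n + 1) × Fin t))
    (he : ∀ k, e k ∈ tupleMatching (Z (j k)))
    (hdisj : Pairwise fun k l => Disjoint (e k) (e l)) (k l : Fin t) : j k = j l := by
  choose s hs using fun k => mem_tupleMatching.1 (he k)
  have hinj : ∀ i, Function.Injective fun k => slotEdge (Z (j k)) (s k) i := by
    intro i k l hkl
    by_contra hne
    have h : Disjoint (e k) (e l) := hdisj hne
    rw [← hs, ← hs, disjoint_graphEdge] at h
    exact h i hkl
  have hsinj : Function.Injective s := fun k l h => hinj 0 (by simpa [slotEdge] using h)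
  let σ : Equiv.Perm (Fin t) := Equiv.ofBijective s (Finite.injective_iff_bijective.1 hsinj)
  have hsσ : ∀ k, s (σ.symm k) = k := fun k => σ.apply_symm_apply k
  let y : Fin n → Equiv.Perm (Fin t) := fun p =>
    σ.symm.trans (Equiv.ofBijective _ (Finite.injective_iff_bijective.1 (hinj p.succ)))
  have h := hZ (fun k => j (σ.symm k)) y (fun k p => by simp [y, slotEdge, hsσ]) (σ k) (σ l)
  simpa using h

lemma mem_rainbowFreeSizes_of_forall_eq {α : Type} {H : Hypergraph α} {r t N : ℕ} (ht : 2 ≤ t)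
    {M : Fin N → Finset (Set α)} (hU : IsUniform H r) (hP : IsPartite H r)
    (hM : ∀ j, IsMatchingOfSize H t (M j))
    (h : ∀ (j : Fin t → Fin N) (e : Fin t → Set α), (∀ k, e k ∈ M (j k)) →
      Pairwise (fun k l => Disjoint (e k) (e l)) → ∀ k l, j k = j l) :
    N ∈ rainbowFreeSizes r t := by
  refine ⟨α, H, M, hU, hP, hM, ?_⟩
  rintro ⟨j, e, hj, he, hd⟩
  have := hj (h j e he hd ⟨0, by omega⟩ ⟨1, by omega⟩)
  simp at this

end RainbowMatching

/-- The counting bound in the form needed, with `D = 2 log C / log t`. -/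
lemma rpow_sub_mul_sqrt_le {t C r N : ℕ} (ht : 2 ≤ t) (hC : 1 ≤ C) (hr : 1 ≤ r)
    (h : t ^ r ≤ N * C ^ (Nat.sqrt r + 1)) :
    (t : ℝ) ^ ((r : ℝ) - 2 * Real.logb t C * √(r : ℝ)) ≤ N := by
  have ht0 : (0 : ℝ) < t := by positivity
  have ht1 : (t : ℝ) ≠ 1 := by norm_cast; omega
  have hC0 : (0 : ℝ) < C := by positivity
  have hC1 : (1 : ℝ) ≤ C := by exact_mod_cast hC
  have hexp : (t : ℝ) ^ (2 * Real.logb t C * √(r : ℝ)) = (C : ℝ) ^ (2 * √(r : ℝ)) := by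
    rw [show 2 * Real.logb t C * √(r : ℝ) = Real.logb t C * (2 * √(r : ℝ)) by ring,
      Real.rpow_mul ht0.le, Real.rpow_logb ht0 ht1 hC0]
  rw [Real.rpow_sub ht0, hexp, Real.rpow_natCast, div_le_iff₀ (by positivity)]
  have hsq : ((Nat.sqrt r + 1 : ℕ) : ℝ) ≤ 2 * √(r : ℝ) := by
    have h1 : ((Nat.sqrt r : ℕ) : ℝ) ≤ √(r : ℝ) := Real.nat_sqrt_le_real_sqrt
    have h2 : (1 : ℝ) ≤ √(r : ℝ) := Real.one_le_sqrt.2 (by exact_mod_cast hr)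
    push_cast
    linarith
  calc (t : ℝ) ^ r ≤ N * (C : ℝ) ^ (Nat.sqrt r + 1) := by exact_mod_cast h
    _ = N * (C : ℝ) ^ ((Nat.sqrt r + 1 : ℕ) : ℝ) := by rw [Real.rpow_natCast]
    _ ≤ N * (C : ℝ) ^ (2 * √(r : ℝ)) := by
        gcongr

theorem theorem1p5 (t : ℕ) (ht : 2 ≤ t) :
    ∃ D : ℝ, 0 ≤ D ∧ ∀ r : ℕ, 2 ≤ r →
      -- `f r t` really is a maximum, and it satisfies the two bounds
      (IsGreatest (RainbowMatching.rainbowFreeSizes r t) (RainbowMatching.f r t) ∧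
        (t : ℝ) ^ ((r : ℝ) - D * √(r : ℝ)) ≤ (RainbowMatching.f r t : ℝ) ∧
        (RainbowMatching.f r t : ℝ) ≤ ((t : ℝ) - 1) * (t : ℝ) ^ r) ∧
      -- many perfect matchings such that any `t` disjoint edges come from a single matching
      ∃ (N : ℕ) (α : Type) (H : Hypergraph α) (M : Fin N → Finset (Set α)),
        (t : ℝ) ^ ((r : ℝ) - D * √(r : ℝ)) ≤ (N : ℝ) ∧
        H.vertexSet.encard = ((t * r : ℕ) : ℕ∞) ∧
        RainbowMatching.IsUniform H r ∧ RainbowMatching.IsPartite H r ∧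
        (∀ j, RainbowMatching.IsMatchingOfSize H t (M j) ∧
          ∀ v ∈ H.vertexSet, ∃ e ∈ M j, v ∈ e) ∧
        ∀ (j : Fin t → Fin N) (e : Fin t → Set α), (∀ k, e k ∈ M (j k)) →
          Pairwise (fun k l => Disjoint (e k) (e l)) → ∀ k l, j k = j l := by
  obtain ⟨C, hC, hmany⟩ := exists_many_tuples t ht
  refine ⟨2 * Real.logb t C, ?_, fun r hr => ?_⟩
  · have := Real.logb_nonneg (b := t) (x := C) (by exact_mod_cast ht) (by exact_mod_cast hC)
    positivity
  obtain ⟨n, rfl⟩ : ∃ n, r = n + 1 := ⟨r - 1, by omega⟩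
  obtain ⟨N, Z, hN, hZ⟩ := hmany n (Nat.sqrt (n + 1) + 1) (by omega)
    ((Nat.le_succ n).trans (Nat.lt_succ_sqrt (n + 1)).le)
  have hNreal := rpow_sub_mul_sqrt_le ht hC (by omega) hN
  have hfree : N ∈ RainbowMatching.rainbowFreeSizes (n + 1) t :=
    RainbowMatching.mem_rainbowFreeSizes_of_forall_eq ht
      (RainbowMatching.isUniform_completePartite _ _)
      (RainbowMatching.isPartite_completePartite _ _)
      (fun j => RainbowMatching.isMatchingOfSize_tupleMatching (Z j))
      (RainbowMatching.eq_of_pairwise_disjoint hZ)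
  have hgreat := RainbowMatching.isGreatest_f (r := n + 1) ht
  refine ⟨⟨hgreat, hNreal.trans (by exact_mod_cast hgreat.2 hfree), ?_⟩, N, _,
    RainbowMatching.completePartite (n + 1) t, fun j => RainbowMatching.tupleMatching (Z j),
    hNreal, ?_, RainbowMatching.isUniform_completePartite _ _,
    RainbowMatching.isPartite_completePartite _ _,
    fun j => ⟨RainbowMatching.isMatchingOfSize_tupleMatching _,
      fun v _ => RainbowMatching.exists_mem_tupleMatching _ v⟩,
    RainbowMatching.eq_of_pairwise_disjoint hZ⟩
  · have h := RainbowMatching.le_of_mem_rainbowFreeSizes ht hgreat.1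
    have h' : ((RainbowMatching.f (n + 1) t : ℕ) : ℝ) ≤ (((t - 1) * t ^ (n + 1) : ℕ) : ℝ) := by
      exact_mod_cast h
    rwa [Nat.cast_mul, Nat.cast_pow, Nat.cast_sub (by omega), Nat.cast_one] at h'
  · change (Set.univ : Set (Fin (n + 1) × Fin t)).encard = _
    rw [Set.encard_univ, ENat.card_eq_coe_fintype_card, Fintype.card_prod, Fintype.card_fin,
      Fintype.card_fin, mul_comm]
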